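/- Let $n\geq 2$ be an integer and let $p_1,p_2\in\mathbb{C}[x]$ be polynomials of degree at most $n-2$. Suppose that there exists a $\mathbb{C}[x]$-algebra automorphism $\Phi$ of the polynomial ring $\mathbb{C}[x][z,t]$ such that $\Phi\equiv\mathrm{id}$ modulo $x$ (that is, $\Phi(f)-f$ lies in the ideal $(x)$ for every $f\in\mathbb{C}[x][z,t]$) and such that $\Phi$ maps the ideal $\left(x^n,\,z^2+t^3+x\,p_1(x)\right)$ of $\mathbb{C}[x][z,t]$ onto the ideal $\left(x^n,\,z^2+t^3+x\,p_2(x)\right)$. Then $p_1=p_2$. -/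

import Mathlib

open Polynomial

/-- The polynomial ring `ℂ[x][z,t]`, as a `ℂ[x]`-algebra. -/
abbrev PolyXZT : Type := MvPolynomial (Fin 2) ℂ[X]

noncomputable section

/-- The element `x` of `ℂ[x][z,t]`. -/
def xVar : PolyXZT := MvPolynomial.C (X : ℂ[X])

/-- The variable `z` of `ℂ[x][z,t]`. -/
def zVar : PolyXZT := MvPolynomial.X 0

/-- The variable `t` of `ℂ[x][z,t]`. -/
def tVar : PolyXZT := MvPolynomial.X 1

/-- The ideal `(x ^ n, z ^ 2 + t ^ 3 + x * p(x))` of `ℂ[x][z,t]`. -/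
def centerIdeal (n : ℕ) (p : ℂ[X]) : Ideal PolyXZT :=
  Ideal.span {xVar ^ n, zVar ^ 2 + tVar ^ 3 + xVar * MvPolynomial.C p}

end

/-! Suppose `p₁ ≠ p₂`, let `m` be the order of vanishing of `p₁ - p₂` at `0`, and work over
`ℂ[x]/(x^(m+2))`. There `x^n` dies, and the automorphism carries `z² + t³ + s₁` to a multiple of `G
= z² + t³ + s₂`, where `s₁ - s₂ = x^(m+1) e` and `e(0) ≠ 0`. Its Jacobian is a unit congruent to `1`
modulo `x`, hence `1`. If such a map is the identity modulo `x^j`, its order-`j` term is divergence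
free, hence the Hamiltonian field of some `H` (`exists_leading_hamiltonian`). For `j ≤ m` the
difference `s₁ - s₂` is not yet visible, so this field is tangent to the cusp and `H = c + q (z² +
t³)` (`eq_C_add_of_poisson_cusp`). The flow of `-x^j q G` preserves the ideal `(G)`, and composing
with it removes the order-`j` term (`exists_congr_succ`). At order `m + 1` what remains is `{H, z² +
t³} + e(0) = w (z² + t³)`. The cusp is singular at the origin, so evaluation there gives `e(0) = 0`,
a contradiction. -/

/-! ### Jacobian bracket and chain rule. -/

section Poisson

variable {R : Type*} [CommRing R]

/-- The Jacobian (Poisson) bracket on the polynomial ring in two variables. -/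
noncomputable def poisson (f g : MvPolynomial (Fin 2) R) : MvPolynomial (Fin 2) R :=
  MvPolynomial.pderiv 0 f * MvPolynomial.pderiv 1 g -
    MvPolynomial.pderiv 1 f * MvPolynomial.pderiv 0 g

lemma poisson_add_left (f g h : MvPolynomial (Fin 2) R) :
    poisson (f + g) h = poisson f h + poisson g h := by
  simp only [poisson, map_add]; ring

lemma poisson_add_right (f g h : MvPolynomial (Fin 2) R) :
    poisson f (g + h) = poisson f g + poisson f h := by
  simp only [poisson, map_add]; ring

lemma poisson_neg_left (f g : MvPolynomial (Fin 2) R) : poisson (-f) g = -poisson f g := by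
  simp only [poisson, map_neg]; ring

lemma poisson_smul_left (r : R) (f g : MvPolynomial (Fin 2) R) :
    poisson (r • f) g = r • poisson f g := by
  simp only [poisson, Derivation.map_smul, smul_sub, smul_mul_assoc]

lemma poisson_smul_right (r : R) (f g : MvPolynomial (Fin 2) R) :
    poisson f (r • g) = r • poisson f g := by
  simp only [poisson, Derivation.map_smul, smul_sub, mul_smul_comm]

lemma poisson_mul_left (f g h : MvPolynomial (Fin 2) R) :
    poisson (f * g) h = f * poisson g h + poisson f h * g := by
  simp only [poisson, MvPolynomial.pderiv_mul]; ring

lemma poisson_mul_right (f g h : MvPolynomial (Fin 2) R) :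
    poisson f (g * h) = g * poisson f h + poisson f g * h := by
  simp only [poisson, MvPolynomial.pderiv_mul]; ring

lemma poisson_self (f : MvPolynomial (Fin 2) R) : poisson f f = 0 := by
  simp only [poisson]; ring

lemma poisson_one_right (f : MvPolynomial (Fin 2) R) : poisson f 1 = 0 := by
  simp [poisson]

lemma poisson_X_zero (f : MvPolynomial (Fin 2) R) :
    poisson f (MvPolynomial.X 0) = -MvPolynomial.pderiv 1 f := by
  simp [poisson]

lemma poisson_X_one (f : MvPolynomial (Fin 2) R) :
    poisson f (MvPolynomial.X 1) = MvPolynomial.pderiv 0 f := by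
  simp [poisson]

lemma pderiv_comm {σ : Type*} (i j : σ) (f : MvPolynomial σ R) :
    MvPolynomial.pderiv i (MvPolynomial.pderiv j f) =
      MvPolynomial.pderiv j (MvPolynomial.pderiv i f) := by
  classical
  have h : ⁅(MvPolynomial.pderiv i : Derivation R (MvPolynomial σ R) (MvPolynomial σ R)),
      (MvPolynomial.pderiv j : Derivation R (MvPolynomial σ R) (MvPolynomial σ R))⁆ = 0 := by
    refine MvPolynomial.derivation_ext (R := R) fun k => ?_
    rw [Derivation.commutator_apply, MvPolynomial.pderiv_X, MvPolynomial.pderiv_X,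
      Pi.single_apply, Pi.single_apply]
    split_ifs <;> simp
  have := congrArg (fun d => d f) h
  simpa [Derivation.commutator_apply, sub_eq_zero] using this

lemma poisson_jacobi (h f g : MvPolynomial (Fin 2) R) :
    poisson h (poisson f g) = poisson f (poisson h g) + poisson (poisson h f) g := by
  simp only [poisson, map_sub, MvPolynomial.pderiv_mul, pderiv_comm (1 : Fin 2) 0]; ring

/-- Bracketing with `f`, as a linear map. -/
noncomputable def poissonLin (f : MvPolynomial (Fin 2) R) :
    MvPolynomial (Fin 2) R →ₗ[R] MvPolynomial (Fin 2) R where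
  toFun := poisson f
  map_add' := poisson_add_right f
  map_smul' r g := poisson_smul_right r f g

lemma poisson_map {S : Type*} [CommRing S] (φ : R →+* S) (f g : MvPolynomial (Fin 2) R) :
    poisson (MvPolynomial.map φ f) (MvPolynomial.map φ g) = MvPolynomial.map φ (poisson f g) := by
  simp [poisson, MvPolynomial.pderiv_map]

lemma pderiv_algHom (Φ : MvPolynomial (Fin 2) R →ₐ[R] MvPolynomial (Fin 2) R) (i : Fin 2)
    (f : MvPolynomial (Fin 2) R) :
    MvPolynomial.pderiv i (Φ f) =
      Φ (MvPolynomial.pderiv 0 f) * MvPolynomial.pderiv i (Φ (MvPolynomial.X 0)) +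
      Φ (MvPolynomial.pderiv 1 f) * MvPolynomial.pderiv i (Φ (MvPolynomial.X 1)) := by
  induction f using MvPolynomial.induction_on with
  | C a =>
    have : Φ (MvPolynomial.C a) = MvPolynomial.C a := Φ.commutes a
    simp [this]
  | add p q hp hq => simp only [map_add, hp, hq]; ring
  | mul_X p k hp =>
    simp only [map_mul, MvPolynomial.pderiv_mul, hp, map_add]
    fin_cases k <;> simp <;> ring

/-- The chain rule for the Jacobian bracket. -/
lemma poisson_algHom (Φ : MvPolynomial (Fin 2) R →ₐ[R] MvPolynomial (Fin 2) R)
    (f g : MvPolynomial (Fin 2) R) :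
    poisson (Φ f) (Φ g) =
      Φ (poisson f g) * poisson (Φ (MvPolynomial.X 0)) (Φ (MvPolynomial.X 1)) := by
  simp only [poisson, pderiv_algHom Φ _ f, pderiv_algHom Φ _ g, map_sub, map_mul]; ring

end Poisson

/-! ### Exponentials of nilpotent Hamiltonian fields. -/

section Exp

variable {R : Type*} [CommRing R] [Algebra ℚ R]

/-- The exponential of a nilpotent derivation respects any bilinear product, associative or not;
here the bracket itself is installed as the multiplication. -/
lemma exp_poisson (D : MvPolynomial (Fin 2) R →ₗ[R] MvPolynomial (Fin 2) R)
    (hD : ∀ f g, D (poisson f g) = poisson f (D g) + poisson (D f) g) (hn : IsNilpotent D)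
    (f g : MvPolynomial (Fin 2) R) :
    IsNilpotent.exp D (poisson f g) = poisson (IsNilpotent.exp D f) (IsNilpotent.exp D g) := by
  let inst : NonUnitalNonAssocRing (MvPolynomial (Fin 2) R) :=
    { (inferInstance : AddCommGroup (MvPolynomial (Fin 2) R)) with
      mul := poisson
      left_distrib := fun a b c => poisson_add_right a b c
      right_distrib := fun a b c => poisson_add_left a b c
      zero_mul := fun a => by
        change poisson 0 a = 0
        simp [poisson]
      mul_zero := fun a => by
        change poisson a 0 = 0
        simp [poisson] }
  refine @Module.End.exp_mul_of_derivation R (MvPolynomial (Fin 2) R) _ inst _ ?_ ?_ _ D hD hn f g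
  · exact @SMulCommClass.mk _ _ _ _ (_) fun r a b => (poisson_smul_right r a b).symm
  · exact @IsScalarTower.mk _ _ _ _ (_) _ fun r a b => poisson_smul_left r a b

/-- The time-one flow of the Hamiltonian vector field `x ^ j • {H, ·}` for nilpotent `x`. -/
lemma exists_hamiltonian_flow {x : R} {N : ℕ} (hx : x ^ N = 0) {j : ℕ} (hj : 1 ≤ j)
    (H : MvPolynomial (Fin 2) R) :
    ∃ Ψ : MvPolynomial (Fin 2) R →ₐ[R] MvPolynomial (Fin 2) R,
      (∀ f g, poisson (Ψ f) (Ψ g) = Ψ (poisson f g)) ∧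
      (∀ f, ∃ r, Ψ f = f + x ^ j • poisson H f + x ^ (j + 1) • r) ∧
      (∀ I : Ideal (MvPolynomial (Fin 2) R), (∀ f ∈ I, poisson H f ∈ I) → ∀ f ∈ I, Ψ f ∈ I) := by
  set D : Module.End R (MvPolynomial (Fin 2) R) := x ^ j • poissonLin H with hDdef
  have hDapp : ∀ f, D f = x ^ j • poisson H f := fun f => rfl
  have hpow : ∀ i, D ^ i = x ^ (j * i) • poissonLin H ^ i := fun i => by
    rw [hDdef, _root_.smul_pow, pow_mul]
  -- The exponent `N + 2` lets the terms of order 0 and 1 be split off for every `N`.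
  have hDN : D ^ (N + 2) = 0 := by
    rw [hpow, pow_eq_zero_of_le (by nlinarith) hx, zero_smul]
  have hnil : IsNilpotent D := ⟨_, hDN⟩
  have hsum : ∀ f, IsNilpotent.exp D f =
      ∑ i ∈ Finset.range (N + 2), (i.factorial : ℚ)⁻¹ • (D ^ i) f := fun f => by
    rw [IsNilpotent.exp_eq_sum hDN]
    simp [LinearMap.sum_apply]
  have hmul : ∀ f g, IsNilpotent.exp D (f * g) = IsNilpotent.exp D f * IsNilpotent.exp D g :=
    Module.End.exp_mul_of_derivation R _ D (fun f g => by
      simp only [hDapp, poisson_mul_right, smul_add, mul_smul_comm, smul_mul_assoc]) hnil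
  have hone : IsNilpotent.exp D 1 = 1 := by
    rw [hsum, Finset.sum_range_succ', Finset.sum_eq_zero]
    · simp
    · intro i _
      rw [pow_succ, Module.End.mul_apply, hDapp, poisson_one_right]
      simp
  refine ⟨AlgHom.ofLinearMap (IsNilpotent.exp D) hone hmul, fun f g => ?_, fun f => ?_,
    fun I hI f hf => ?_⟩
  · refine (exp_poisson D (fun f g => ?_) hnil f g).symm
    simp only [hDapp]
    rw [poisson_jacobi, poisson_smul_right, poisson_smul_left, smul_add]
  · refine ⟨∑ i ∈ Finset.range N, ((i + 1 + 1).factorial : ℚ)⁻¹ •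
      x ^ (j * (i + 1 + 1) - (j + 1)) • (poissonLin H ^ (i + 1 + 1)) f, ?_⟩
    change IsNilpotent.exp D f = _
    rw [hsum, Finset.sum_range_succ', Finset.sum_range_succ', Finset.smul_sum]
    have : ∀ i ∈ Finset.range N, ((i + 1 + 1).factorial : ℚ)⁻¹ • (D ^ (i + 1 + 1)) f =
        x ^ (j + 1) • ((i + 1 + 1).factorial : ℚ)⁻¹ •
          x ^ (j * (i + 1 + 1) - (j + 1)) • (poissonLin H ^ (i + 1 + 1)) f := fun i _ => by
      rw [hpow, LinearMap.smul_apply, smul_comm (x ^ (j + 1)), smul_smul (x ^ (j + 1)), ← pow_add,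
        Nat.add_sub_cancel' (by nlinarith)]
    rw [Finset.sum_congr rfl this]
    simp [hDapp]
    ring
  · change IsNilpotent.exp D f ∈ I
    rw [hsum]
    have hD : ∀ i, (D ^ i) f ∈ I := fun i => by
      induction i with
      | zero => simpa using hf
      | succ i ih =>
        rw [pow_succ', Module.End.mul_apply, hDapp]
        exact I.smul_of_tower_mem _ (hI _ ih)
    exact I.sum_mem fun i _ => by
      rw [← algebraMap_smul R]
      exact I.smul_of_tower_mem _ (hD i)

end Exp

/-! ### Hamiltonian fields in the plane and functions on the cusp. -/

section Cusp

/-- Formal integration of polynomials in the variable `i`. -/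
noncomputable def mvIntegrate (i : Fin 2) :
    MvPolynomial (Fin 2) ℂ →ₗ[ℂ] MvPolynomial (Fin 2) ℂ :=
  (MvPolynomial.basisMonomials (Fin 2) ℂ).constr ℂ fun m =>
    MvPolynomial.monomial (m + Finsupp.single i 1) ((m i + 1 : ℂ)⁻¹)

lemma mvIntegrate_monomial (i : Fin 2) (m : Fin 2 →₀ ℕ) (a : ℂ) :
    mvIntegrate i (MvPolynomial.monomial m a) =
      MvPolynomial.monomial (m + Finsupp.single i 1) (a * (m i + 1 : ℂ)⁻¹) := by
  have h : MvPolynomial.monomial m a = a • MvPolynomial.basisMonomials (Fin 2) ℂ m := by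
    simp [MvPolynomial.smul_monomial]
  rw [h, map_smul, mvIntegrate, Module.Basis.constr_basis, MvPolynomial.smul_monomial, smul_eq_mul]

lemma pderiv_mvIntegrate (i : Fin 2) (f : MvPolynomial (Fin 2) ℂ) :
    MvPolynomial.pderiv i (mvIntegrate i f) = f := by
  induction f using MvPolynomial.induction_on' with
  | monomial m a =>
    rw [mvIntegrate_monomial, MvPolynomial.pderiv_monomial, add_tsub_cancel_right]
    have : ((m i : ℂ) + 1) ≠ 0 := Nat.cast_add_one_ne_zero _
    simp [this]
  | add p q hp hq => rw [map_add, map_add, hp, hq]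

lemma pderiv_mvIntegrate_of_ne {i j : Fin 2} (hij : i ≠ j) (f : MvPolynomial (Fin 2) ℂ) :
    MvPolynomial.pderiv j (mvIntegrate i f) = mvIntegrate i (MvPolynomial.pderiv j f) := by
  induction f using MvPolynomial.induction_on' with
  | monomial m a =>
    rw [mvIntegrate_monomial, MvPolynomial.pderiv_monomial, MvPolynomial.pderiv_monomial,
      mvIntegrate_monomial]
    rcases Nat.eq_zero_or_pos (m j) with h | h
    · simp [hij, h]
    · have e : m + Finsupp.single i 1 - Finsupp.single j 1 =
          m - Finsupp.single j 1 + Finsupp.single i 1 := by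
        ext k
        simp only [Finsupp.coe_tsub, Finsupp.coe_add, Pi.sub_apply, Pi.add_apply,
          Finsupp.single_apply]
        split_ifs <;> subst_vars <;> omega
      rw [e]
      congr 1
      simp [hij, hij.symm]
      ring
  | add p q hp hq => simp only [map_add, hp, hq]

/-- A divergence-free polynomial vector field on the plane is Hamiltonian. -/
lemma exists_hamiltonian {α β : MvPolynomial (Fin 2) ℂ}
    (h : MvPolynomial.pderiv 0 α + MvPolynomial.pderiv 1 β = 0) :
    ∃ H, poisson H (MvPolynomial.X 0) = α ∧ poisson H (MvPolynomial.X 1) = β := by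
  set H₁ := mvIntegrate 1 (-α)
  set γ := β - MvPolynomial.pderiv 0 H₁ with hγ
  have h1 : MvPolynomial.pderiv 1 H₁ = -α := pderiv_mvIntegrate 1 _
  have hγ1 : MvPolynomial.pderiv 1 γ = 0 := by
    rw [hγ, map_sub, pderiv_comm, h1, map_neg, sub_neg_eq_add, add_comm, h]
  refine ⟨H₁ + mvIntegrate 0 γ, ?_, ?_⟩
  · rw [poisson_X_zero, map_add, h1, pderiv_mvIntegrate_of_ne (by decide), hγ1, map_zero, add_zero,
      neg_neg]
  · rw [poisson_X_one, map_add, pderiv_mvIntegrate, hγ]; ring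

/-- The equation `z ^ 2 + t ^ 3` of the cuspidal cubic. -/
noncomputable def cusp (R : Type*) [CommRing R] : MvPolynomial (Fin 2) R :=
  MvPolynomial.X 0 ^ 2 + MvPolynomial.X 1 ^ 3

lemma poisson_cusp {R : Type*} [CommRing R] (h : MvPolynomial (Fin 2) R) :
    poisson h (cusp R) = 2 * MvPolynomial.X 0 * poisson h (MvPolynomial.X 0) +
      3 * MvPolynomial.X 1 ^ 2 * poisson h (MvPolynomial.X 1) := by
  rw [cusp, poisson_add_right, pow_succ, pow_succ, pow_succ, pow_succ, pow_succ]
  simp only [poisson_mul_right, pow_zero, one_mul]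
  ring

/-- The parametrization `z = T ^ 3`, `t = - T ^ 2` of the cuspidal cubic. -/
noncomputable def cuspParam : MvPolynomial (Fin 2) ℂ →ₐ[ℂ] ℂ[X] :=
  MvPolynomial.aeval ![(X : ℂ[X]) ^ 3, -X ^ 2]

lemma cuspParam_zero : cuspParam (MvPolynomial.X 0) = X ^ 3 := by simp [cuspParam]

lemma cuspParam_one : cuspParam (MvPolynomial.X 1) = -X ^ 2 := by simp [cuspParam]

lemma cuspParam_cusp : cuspParam (cusp ℂ) = 0 := by
  simp only [cusp, map_add, map_pow, cuspParam_zero, cuspParam_one]; ring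

lemma derivative_cuspParam (f : MvPolynomial (Fin 2) ℂ) :
    derivative (cuspParam f) = cuspParam (MvPolynomial.pderiv 0 f) * (3 * X ^ 2) -
      cuspParam (MvPolynomial.pderiv 1 f) * (2 * X) := by
  induction f using MvPolynomial.induction_on with
  | C a =>
    have : cuspParam (MvPolynomial.C a) = C a := cuspParam.commutes a
    simp [this]
  | add p q hp hq => simp only [map_add, hp, hq]; ring
  | mul_X p k hp =>
    simp only [map_mul, MvPolynomial.pderiv_mul, derivative_mul, hp, map_add]
    fin_cases k
    · have h2 : (C 2 : ℂ[X]) = 2 := rfl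
      simp [cuspParam_zero, h2]; ring
    · simp [cuspParam_one]; ring

/-- On the normalization, the Hamiltonian field of the cusp equation becomes `T² d/dT` up to sign
convention, so a function it kills there is constant. -/
lemma cuspParam_poisson_cusp (f : MvPolynomial (Fin 2) ℂ) :
    cuspParam (poisson f (cusp ℂ)) = X ^ 2 * derivative (cuspParam f) := by
  rw [poisson_cusp, poisson_X_zero, poisson_X_one, derivative_cuspParam]
  simp only [map_add, map_mul, map_neg, map_pow, cuspParam_zero, cuspParam_one, map_ofNat]
  ring

lemma exists_normal_form_mod_cusp (f : MvPolynomial (Fin 2) ℂ) :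
    ∃ (A B : ℂ[X]) (q : MvPolynomial (Fin 2) ℂ),
      f = aeval (MvPolynomial.X 1) A + MvPolynomial.X 0 * aeval (MvPolynomial.X 1) B +
        q * cusp ℂ := by
  induction f using MvPolynomial.induction_on with
  | C a => exact ⟨C a, 0, 0, by simp [MvPolynomial.algebraMap_eq]⟩
  | add p q hp hq =>
    obtain ⟨A, B, u, rfl⟩ := hp
    obtain ⟨A', B', u', rfl⟩ := hq
    exact ⟨A + A', B + B', u + u', by simp only [map_add]; ring⟩
  | mul_X p k hp =>
    obtain ⟨A, B, u, rfl⟩ := hp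
    fin_cases k
    · refine ⟨-X ^ 3 * B, A, u * MvPolynomial.X 0 + aeval (MvPolynomial.X 1) B, ?_⟩
      simp [cusp]; ring
    · refine ⟨X * A, X * B, u * MvPolynomial.X 1, ?_⟩
      simp; ring

lemma comp_neg_X_sq_eq_zero {A : ℂ[X]} (h : A.comp (-X ^ 2) = 0) : A = 0 := by
  have h2 : (-X ^ 2 : ℂ[X]).natDegree = 2 := by simp
  rcases Polynomial.comp_eq_zero_iff.1 h with h | h
  · exact h
  · rw [h.2, natDegree_C] at h2
    omega

/-- In the normal form `A(t) + z B(t)`, the two summands pull back to the even and odd parts in `T`;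
the substitution `T ↦ -T` separates them. -/
lemma cusp_dvd_of_cuspParam_eq_zero {f : MvPolynomial (Fin 2) ℂ} (hf : cuspParam f = 0) :
    ∃ q, f = q * cusp ℂ := by
  obtain ⟨A, B, q, rfl⟩ := exists_normal_form_mod_cusp f
  have key : ∀ A : ℂ[X], cuspParam (aeval (MvPolynomial.X 1) A) = A.comp (-X ^ 2) := fun A => by
    rw [← Polynomial.aeval_algHom_apply, cuspParam_one, comp_eq_aeval]
  simp only [map_add, map_mul, cuspParam_cusp, key, cuspParam_zero, mul_zero, add_zero] at hf
  have hf' := congrArg (fun p : ℂ[X] => p.comp (-X)) hf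
  simp only [add_comp, mul_comp, comp_assoc, pow_comp, neg_comp, X_comp, zero_comp] at hf'
  have e : (-X : ℂ[X]) ^ 2 = X ^ 2 := by ring
  rw [e] at hf'
  have hA : A.comp (-X ^ 2) = 0 := by
    have h2 : 2 * A.comp (-X ^ 2) = 0 := by linear_combination hf + hf'
    exact (mul_eq_zero.1 h2).resolve_left two_ne_zero
  have hB : B = 0 := by
    rw [hA, zero_add] at hf
    exact comp_neg_X_sq_eq_zero ((mul_eq_zero.1 hf).resolve_left (by simp))
  exact ⟨q, by simp [comp_neg_X_sq_eq_zero hA, hB]⟩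

/-- A function whose Hamiltonian vector field is tangent to the cusp is constant along it. -/
lemma eq_C_add_of_poisson_cusp {h w : MvPolynomial (Fin 2) ℂ}
    (hw : poisson h (cusp ℂ) = w * cusp ℂ) : ∃ c q, h = MvPolynomial.C c + q * cusp ℂ := by
  have h1 := cuspParam_poisson_cusp h
  rw [hw, map_mul, cuspParam_cusp, mul_zero] at h1
  have h2 := (mul_eq_zero.1 h1.symm).resolve_left (by simp)
  obtain ⟨c, hc⟩ : ∃ c, cuspParam h = C c := ⟨_, eq_C_of_derivative_eq_zero h2⟩
  have hc' : cuspParam (MvPolynomial.C c) = C c := cuspParam.commutes c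
  obtain ⟨q, hq⟩ := cusp_dvd_of_cuspParam_eq_zero (f := h - MvPolynomial.C c) (by
    rw [map_sub, hc, hc', sub_self])
  exact ⟨c, q, by rw [← hq]; ring⟩

lemma cusp_ne_zero : cusp ℂ ≠ 0 := fun h => by
  have := congrArg (MvPolynomial.eval ![1, 0]) h
  simp [cusp] at this

end Cusp

/-! ### Order-by-order argument over a truncated base. -/

section Truncated

lemma map_cusp {R S : Type*} [CommRing R] [CommRing S] (φ : R →+* S) :
    MvPolynomial.map φ (cusp R) = cusp S := by
  simp [cusp]

lemma map_smul_eq {R S : Type*} [CommRing R] [CommRing S] (φ : R →+* S) (r : R) (f : MvPolynomial (Fin 2) R) :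
    MvPolynomial.map φ (r • f) = φ r • MvPolynomial.map φ f := by
  simp [MvPolynomial.smul_eq_C_mul]

/-- `ε : R → ℂ` is the residue map of a `ℂ`-algebra in which `x` behaves like the class of `X` in
`ℂ[X] / (X ^ N)`. -/
structure IsTruncated {R : Type*} [CommRing R] [Algebra ℂ R] (ε : R →+* ℂ) (x : R) (N : ℕ) :
    Prop where
  algebraMap_eq : ∀ c, ε (algebraMap ℂ R c) = c
  map_x : ε x = 0
  pow_eq_zero : x ^ N = 0
  exists_of_eq_zero : ∀ r, ε r = 0 → ∃ s, r = x * s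
  eq_zero_of_mul : ∀ j < N, ∀ r, x ^ j * r = 0 → ε r = 0

variable {R : Type*} [CommRing R] [Algebra ℂ R] {ε : R →+* ℂ} {x : R} {N : ℕ}

namespace IsTruncated

lemma map_x_smul (h : IsTruncated ε x N) (f : MvPolynomial (Fin 2) R) :
    MvPolynomial.map ε (x • f) = 0 := by
  rw [map_smul_eq, h.map_x, zero_smul]

lemma map_x_pow_smul (h : IsTruncated ε x N) {j : ℕ} (hj : 1 ≤ j) (f : MvPolynomial (Fin 2) R) :
    MvPolynomial.map ε (x ^ j • f) = 0 := by
  rw [map_smul_eq, map_pow, h.map_x, zero_pow (by omega), zero_smul]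

lemma exists_smul (h : IsTruncated ε x N) {f : MvPolynomial (Fin 2) R}
    (hf : MvPolynomial.map ε f = 0) : ∃ g, f = x • g := by
  have : MvPolynomial.C x ∣ f := by
    rw [MvPolynomial.C_dvd_iff_dvd_coeff]
    intro m
    refine h.exists_of_eq_zero _ ?_
    rw [← MvPolynomial.coeff_map, hf, MvPolynomial.coeff_zero]
  obtain ⟨g, rfl⟩ := this
  exact ⟨g, (MvPolynomial.smul_eq_C_mul _ _).symm⟩

lemma map_eq_zero_of_smul (h : IsTruncated ε x N) {j : ℕ} (hj : j < N)
    {f : MvPolynomial (Fin 2) R} (hf : x ^ j • f = 0) : MvPolynomial.map ε f = 0 := by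
  ext m
  rw [MvPolynomial.coeff_map, MvPolynomial.coeff_zero]
  refine h.eq_zero_of_mul j hj _ ?_
  have := congrArg (MvPolynomial.coeff m) hf
  rwa [MvPolynomial.coeff_smul, smul_eq_mul, MvPolynomial.coeff_zero] at this

/-- Powers of `x` are extracted one at a time: `G` is nonzero modulo `x`, and the residue ring is a
domain. -/
lemma exists_smul_of_mul_eq (h : IsTruncated ε x N) {G v : MvPolynomial (Fin 2) R}
    (hG : MvPolynomial.map ε G ≠ 0) {j : ℕ} (hj : j ≤ N) {m : MvPolynomial (Fin 2) R}
    (hv : v * G = x ^ j • m) : ∃ w, v = x ^ j • w := by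
  induction j generalizing m with
  | zero => exact ⟨v, by simp⟩
  | succ j ih =>
    obtain ⟨w, rfl⟩ := ih (m := x • m) (by omega) (by rw [hv, smul_smul, pow_succ])
    have h1 : x ^ j • (w * G - x • m) = 0 := by
      rw [smul_sub, ← smul_mul_assoc, hv, smul_smul, pow_succ, sub_self]
    have h2 := h.map_eq_zero_of_smul (by omega) h1
    rw [map_sub, h.map_x_smul, sub_zero, map_mul] at h2
    obtain ⟨g, rfl⟩ := h.exists_smul ((mul_eq_zero.1 h2).resolve_right hG)
    exact ⟨g, by rw [smul_smul, pow_succ]⟩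

/-- The leading term of a Jacobian one map `Φ ≡ id` modulo `x ^ j` is Hamiltonian, and the
transformation of the cusp equation under `Φ` is governed by its Hamiltonian. -/
lemma exists_leading_hamiltonian (h : IsTruncated ε x N) {j : ℕ} (hj : 1 ≤ j) (hjN : j < N)
    {Φ : MvPolynomial (Fin 2) R →ₐ[R] MvPolynomial (Fin 2) R} {α β : MvPolynomial (Fin 2) R}
    (hz : Φ (MvPolynomial.X 0) = MvPolynomial.X 0 + x ^ j • α)
    (ht : Φ (MvPolynomial.X 1) = MvPolynomial.X 1 + x ^ j • β)
    (hJ : poisson (Φ (MvPolynomial.X 0)) (Φ (MvPolynomial.X 1)) = 1)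
    {s₁ s₂ b : R} (hs₂ : ε s₂ = 0) (hs : s₁ = s₂ + x ^ j * b) {u : MvPolynomial (Fin 2) R}
    (hu : Φ (cusp R + MvPolynomial.C s₁) = u * (cusp R + MvPolynomial.C s₂)) :
    ∃ H w, MvPolynomial.map ε α = poisson H (MvPolynomial.X 0) ∧
      MvPolynomial.map ε β = poisson H (MvPolynomial.X 1) ∧
      poisson H (cusp ℂ) + MvPolynomial.C (ε b) = w * cusp ℂ := by
  have hdiv : x ^ j • (MvPolynomial.pderiv 0 α + MvPolynomial.pderiv 1 β +
      x ^ j • poisson α β) = 0 := by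
    have e : poisson (Φ (MvPolynomial.X 0)) (Φ (MvPolynomial.X 1)) =
        1 + x ^ j • (MvPolynomial.pderiv 0 α + MvPolynomial.pderiv 1 β + x ^ j • poisson α β) := by
      rw [hz, ht, poisson_add_left, poisson_add_right, poisson_add_right, poisson_X_one,
        poisson_smul_left, poisson_smul_left, poisson_smul_right, poisson_smul_right,
        poisson_X_one]
      have : poisson (MvPolynomial.X 0) β = MvPolynomial.pderiv 1 β := by simp [poisson]
      rw [this, MvPolynomial.pderiv_X_self]
      simp only [smul_add]
      ring
    rw [hJ] at e
    exact left_eq_add.1 e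
  have hdiv' := h.map_eq_zero_of_smul hjN hdiv
  rw [map_add, map_add, h.map_x_pow_smul hj, add_zero, ← MvPolynomial.pderiv_map,
    ← MvPolynomial.pderiv_map] at hdiv'
  obtain ⟨H, hH0, hH1⟩ := exists_hamiltonian hdiv'
  have hM : (u - 1) * (cusp R + MvPolynomial.C s₂) = x ^ j •
      (2 * MvPolynomial.X 0 * α + 3 * MvPolynomial.X 1 ^ 2 * β + MvPolynomial.C b +
        x ^ j • (α ^ 2 + 3 * MvPolynomial.X 1 * β ^ 2 + x ^ j • β ^ 3)) := by
    have hC : Φ (MvPolynomial.C s₁) = MvPolynomial.C s₁ := Φ.commutes s₁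
    rw [sub_mul, ← hu, map_add, hC, cusp, map_add, map_pow, map_pow, hz, ht, hs]
    simp only [MvPolynomial.smul_eq_C_mul, map_add, map_mul]
    ring
  have hG : MvPolynomial.map ε (cusp R + MvPolynomial.C s₂) = cusp ℂ := by
    rw [map_add, map_cusp, MvPolynomial.map_C, hs₂, map_zero, add_zero]
  obtain ⟨w, hw⟩ := h.exists_smul_of_mul_eq (by rw [hG]; exact cusp_ne_zero) hjN.le hM
  rw [hw, smul_mul_assoc, ← sub_eq_zero, ← smul_sub] at hM
  have hM' := h.map_eq_zero_of_smul hjN hM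
  rw [map_sub, map_mul, hG, map_add, h.map_x_pow_smul hj, add_zero] at hM'
  refine ⟨H, MvPolynomial.map ε w, hH0.symm, hH1.symm, ?_⟩
  rw [poisson_cusp, hH0, hH1, sub_eq_zero.1 hM']
  simp

lemma exists_congr_succ (h : IsTruncated ε x N) [Algebra ℚ R] {j : ℕ} (hj : 1 ≤ j) (hjN : j < N)
    {s₁ s₂ b : R} (hs₂ : ε s₂ = 0) (hs : s₁ = s₂ + x ^ j * b) (hb : ε b = 0)
    (hΦ : ∃ (Φ : MvPolynomial (Fin 2) R →ₐ[R] MvPolynomial (Fin 2) R)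
      (α β u : MvPolynomial (Fin 2) R),
      poisson (Φ (MvPolynomial.X 0)) (Φ (MvPolynomial.X 1)) = 1 ∧
      Φ (MvPolynomial.X 0) = MvPolynomial.X 0 + x ^ j • α ∧
      Φ (MvPolynomial.X 1) = MvPolynomial.X 1 + x ^ j • β ∧
      Φ (cusp R + MvPolynomial.C s₁) = u * (cusp R + MvPolynomial.C s₂)) :
    ∃ (Φ : MvPolynomial (Fin 2) R →ₐ[R] MvPolynomial (Fin 2) R)
      (α β u : MvPolynomial (Fin 2) R),
      poisson (Φ (MvPolynomial.X 0)) (Φ (MvPolynomial.X 1)) = 1 ∧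
      Φ (MvPolynomial.X 0) = MvPolynomial.X 0 + x ^ (j + 1) • α ∧
      Φ (MvPolynomial.X 1) = MvPolynomial.X 1 + x ^ (j + 1) • β ∧
      Φ (cusp R + MvPolynomial.C s₁) = u * (cusp R + MvPolynomial.C s₂) := by
  obtain ⟨Φ, α, β, u, hJ, hz, ht, hu⟩ := hΦ
  obtain ⟨H, w, hα, hβ, hw⟩ := h.exists_leading_hamiltonian hj hjN hz ht hJ hs₂ hs hu
  rw [hb, map_zero, add_zero] at hw
  obtain ⟨c, q, rfl⟩ := eq_C_add_of_poisson_cusp hw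
  set G := cusp R + MvPolynomial.C s₂ with hGdef
  -- The lift uses the deformed equation `G` rather than the cusp, so that bracketing with `K`
  -- preserves `(G)` exactly.
  set K := -(MvPolynomial.map (algebraMap ℂ R) q * G) with hK
  have hred : MvPolynomial.map ε K = -(q * cusp ℂ) := by
    have e : ε.comp (algebraMap ℂ R) = RingHom.id ℂ := RingHom.ext h.algebraMap_eq
    rw [hK, map_neg, map_mul, MvPolynomial.map_map, e, MvPolynomial.map_id, hGdef, map_add,
      map_cusp, MvPolynomial.map_C, hs₂, map_zero, add_zero]
  obtain ⟨Ψ, hΨp, hΨ1, hΨI⟩ := exists_hamiltonian_flow h.pow_eq_zero hj K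
  have step : ∀ (i : Fin 2) (γ : MvPolynomial (Fin 2) R),
      Φ (MvPolynomial.X i) = MvPolynomial.X i + x ^ j • γ →
      MvPolynomial.map ε γ = poisson (MvPolynomial.C c + q * cusp ℂ) (MvPolynomial.X i) →
      ∃ γ', Ψ (Φ (MvPolynomial.X i)) = MvPolynomial.X i + x ^ (j + 1) • γ' := by
    intro i γ hi hγ
    obtain ⟨r, hr⟩ := hΨ1 (MvPolynomial.X i)
    obtain ⟨r', hr'⟩ := hΨ1 γ
    have h0 : MvPolynomial.map ε (poisson K (MvPolynomial.X i) + γ) = 0 := by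
      rw [map_add, ← poisson_map, hred, hγ, MvPolynomial.map_X]
      simp only [poisson, map_add, map_neg, MvPolynomial.pderiv_C]
      ring
    obtain ⟨g, hg⟩ := h.exists_smul h0
    -- Since `j ≥ 1`, the cross term of order `2j` is divisible by `x^(j+1)`.
    obtain ⟨j, rfl⟩ : ∃ i, j = i + 1 := ⟨j - 1, by omega⟩
    refine ⟨g + r + x ^ j • poisson K γ + x ^ (j + 1) • r', ?_⟩
    rw [hi, map_add, map_smul, hr, hr']
    have hg' := congrArg (fun p => x ^ (j + 1) • p) hg
    simp only [MvPolynomial.smul_eq_C_mul, map_pow] at hg' ⊢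
    linear_combination hg'
  obtain ⟨α', hα'⟩ := step 0 α hz hα
  obtain ⟨β', hβ'⟩ := step 1 β ht hβ
  have hΨG : Ψ G ∈ Ideal.span {G} := by
    refine hΨI _ (fun f hf => ?_) G (Ideal.mem_span_singleton_self G)
    obtain ⟨g, rfl⟩ := Ideal.mem_span_singleton'.1 hf
    refine Ideal.mem_span_singleton'.2
      ⟨-(MvPolynomial.map (algebraMap ℂ R) q * poisson G g +
        poisson (MvPolynomial.map (algebraMap ℂ R) q) (g * G)), ?_⟩
    rw [hK, poisson_neg_left, poisson_mul_left, poisson_mul_right G, poisson_self]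
    ring
  obtain ⟨v, hv⟩ := Ideal.mem_span_singleton'.1 hΨG
  refine ⟨Ψ.comp Φ, α', β', Ψ u * v, ?_, hα', hβ', ?_⟩
  · rw [AlgHom.comp_apply, AlgHom.comp_apply, hΨp, hJ, map_one]
  · rw [AlgHom.comp_apply, hu, map_mul, ← hv, mul_assoc]

/-- A Jacobian one map congruent to the identity modulo `x` cannot move the parameter of the
deformation `z ^ 2 + t ^ 3 + s` of the cusp. -/
lemma residue_eq_zero [Algebra ℚ R] {k : ℕ} (h : IsTruncated ε x (k + 1)) (hk : 1 ≤ k)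
    {s₁ s₂ a : R} (hs₂ : ε s₂ = 0) (hs : s₁ = s₂ + x ^ k * a)
    {Φ : MvPolynomial (Fin 2) R →ₐ[R] MvPolynomial (Fin 2) R} {α β u : MvPolynomial (Fin 2) R}
    (hJ : poisson (Φ (MvPolynomial.X 0)) (Φ (MvPolynomial.X 1)) = 1)
    (hz : Φ (MvPolynomial.X 0) = MvPolynomial.X 0 + x • α)
    (ht : Φ (MvPolynomial.X 1) = MvPolynomial.X 1 + x • β)
    (hu : Φ (cusp R + MvPolynomial.C s₁) = u * (cusp R + MvPolynomial.C s₂)) : ε a = 0 := by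
  have key : ∀ j, 1 ≤ j → j ≤ k →
      ∃ (Φ : MvPolynomial (Fin 2) R →ₐ[R] MvPolynomial (Fin 2) R)
        (α β u : MvPolynomial (Fin 2) R),
        poisson (Φ (MvPolynomial.X 0)) (Φ (MvPolynomial.X 1)) = 1 ∧
        Φ (MvPolynomial.X 0) = MvPolynomial.X 0 + x ^ j • α ∧
        Φ (MvPolynomial.X 1) = MvPolynomial.X 1 + x ^ j • β ∧
        Φ (cusp R + MvPolynomial.C s₁) = u * (cusp R + MvPolynomial.C s₂) := by
    intro j hj
    induction j, hj using Nat.le_induction with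
    | base => exact fun _ => ⟨Φ, α, β, u, hJ, by rwa [pow_one], by rwa [pow_one], hu⟩
    | succ j hj ih =>
      intro hjk
      refine h.exists_congr_succ (b := x ^ (k - j) * a) hj (by omega) hs₂ ?_ ?_ (ih (by omega))
      · rw [hs, ← mul_assoc, ← pow_add, Nat.add_sub_cancel' (by omega)]
      · rw [map_mul, map_pow, h.map_x, zero_pow (by omega), zero_mul]
  obtain ⟨Φ, α, β, u, hJ, hz, ht, hu⟩ := key k hk le_rfl
  obtain ⟨H, w, -, -, hw⟩ := h.exists_leading_hamiltonian hk (by omega) hz ht hJ hs₂ hs hu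
  -- The cusp equation and both its partial derivatives vanish at the origin.
  have := congrArg (MvPolynomial.eval 0) hw
  rw [poisson_cusp] at this
  simpa [cusp] using this

end IsTruncated

/-- The residue map `ℂ[X] / (X ^ N) → ℂ`. -/
noncomputable def truncResidue (N : ℕ) :
    ℂ[X] ⧸ Ideal.span {(X : ℂ[X]) ^ (N + 1)} →+* ℂ :=
  Ideal.Quotient.lift _ (evalRingHom 0) fun a ha => by
    obtain ⟨b, rfl⟩ := Ideal.mem_span_singleton.1 ha
    simp

lemma truncResidue_mk (N : ℕ) (p : ℂ[X]) :
    truncResidue N (Ideal.Quotient.mk _ p) = p.eval 0 := rfl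

lemma isTruncated_truncResidue (N : ℕ) :
    IsTruncated (truncResidue N) (Ideal.Quotient.mk _ X) (N + 1) where
  algebraMap_eq c := by
    change truncResidue N (Ideal.Quotient.mk _ (C c)) = c
    rw [truncResidue_mk, eval_C]
  map_x := by rw [truncResidue_mk, eval_X]
  pow_eq_zero := by
    rw [← map_pow, Ideal.Quotient.eq_zero_iff_mem]
    exact Ideal.mem_span_singleton_self _
  exists_of_eq_zero r hr := by
    obtain ⟨p, rfl⟩ := Ideal.Quotient.mk_surjective r
    rw [truncResidue_mk, ← coeff_zero_eq_eval_zero] at hr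
    obtain ⟨q, rfl⟩ := X_dvd_iff.2 hr
    exact ⟨Ideal.Quotient.mk _ q, map_mul _ _ _⟩
  eq_zero_of_mul j hj r hr := by
    obtain ⟨p, rfl⟩ := Ideal.Quotient.mk_surjective r
    rw [← map_pow, ← map_mul, Ideal.Quotient.eq_zero_iff_mem, Ideal.mem_span_singleton] at hr
    rw [truncResidue_mk, ← coeff_zero_eq_eval_zero, ← X_dvd_iff]
    have h1 : (X : ℂ[X]) ^ j * X ∣ X ^ j * p := by
      rw [← pow_succ]
      exact (pow_dvd_pow _ (by omega)).trans hr
    exact (mul_dvd_mul_iff_left (pow_ne_zero _ X_ne_zero)).1 h1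

end Truncated

/-! ### Jacobian of the automorphism. -/

section Automorphism

lemma exists_eq_add_smul {f g : PolyXZT} (h : f - g ∈ Ideal.span {xVar}) :
    ∃ α : PolyXZT, f = g + (X : ℂ[X]) • α := by
  obtain ⟨α, hα⟩ := Ideal.mem_span_singleton.1 h
  exact ⟨α, by rw [MvPolynomial.smul_eq_C_mul, ← xVar, ← hα]; ring⟩

/-- A `ℂ[x]`-automorphism of `ℂ[x][z,t]` congruent to the identity modulo `x` has Jacobian one. -/
lemma poisson_algEquiv_eq_one (Φ : PolyXZT ≃ₐ[ℂ[X]] PolyXZT)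
    (h : ∀ f : PolyXZT, Φ f - f ∈ Ideal.span {xVar}) :
    poisson (Φ (MvPolynomial.X 0)) (Φ (MvPolynomial.X 1)) = 1 := by
  have hunit : IsUnit (poisson (Φ (MvPolynomial.X 0)) (Φ (MvPolynomial.X 1))) := by
    have e := poisson_algHom (Φ : PolyXZT →ₐ[ℂ[X]] PolyXZT) (Φ.symm (MvPolynomial.X 0))
      (Φ.symm (MvPolynomial.X 1))
    simp only [AlgEquiv.coe_toAlgHom, AlgEquiv.apply_symm_apply] at e
    rw [poisson_X_one, MvPolynomial.pderiv_X_self] at e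
    exact IsUnit.of_mul_eq_one_right _ e.symm
  -- Units of `ℂ[x][z,t]` are nonzero complex constants, so reduction modulo `x` determines the
  -- Jacobian.
  obtain ⟨r, hr, hJ⟩ := MvPolynomial.isUnit_iff_eq_C_of_isReduced.1 hunit
  obtain ⟨c, -, rfl⟩ := Polynomial.isUnit_iff.1 hr
  have hred : ∀ i : Fin 2, MvPolynomial.map (evalRingHom (0 : ℂ)) (Φ (MvPolynomial.X i)) =
      MvPolynomial.X i := fun i => by
    obtain ⟨α, hα⟩ := exists_eq_add_smul (h (MvPolynomial.X i))
    rw [hα, map_add, map_smul_eq]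
    simp
  have e := poisson_map (evalRingHom (0 : ℂ)) (Φ (MvPolynomial.X 0)) (Φ (MvPolynomial.X 1))
  rw [hred, hred, poisson_X_one, MvPolynomial.pderiv_X_self, hJ, MvPolynomial.map_C,
    coe_evalRingHom, eval_C] at e
  rw [hJ, (MvPolynomial.C_injective (Fin 2) ℂ (by rw [← e, map_one]) : c = 1)]
  simp

end Automorphism

/-! ### Reduction to the truncated ring. -/

theorem mainTheorem4 (n : ℕ) (hn : 2 ≤ n) (p₁ p₂ : ℂ[X])
    (hp₁ : p₁.natDegree ≤ n - 2) (hp₂ : p₂.natDegree ≤ n - 2)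
    (h : ∃ Φ : PolyXZT ≃ₐ[ℂ[X]] PolyXZT,
      (∀ f : PolyXZT, Φ f - f ∈ Ideal.span {xVar}) ∧
      (centerIdeal n p₁).map Φ = centerIdeal n p₂) :
    p₁ = p₂ := by
  obtain ⟨Φ, hΦ, hI⟩ := h
  by_contra hne
  have hd : p₁ - p₂ ≠ 0 := sub_ne_zero.2 hne
  obtain ⟨e, he, he0⟩ : ∃ e : ℂ[X], p₁ - p₂ = X ^ (p₁ - p₂).natTrailingDegree * e ∧
      e.eval 0 ≠ 0 := by
    obtain ⟨e, he⟩ := X_pow_dvd_iff.2 (fun d (hd : d < (p₁ - p₂).natTrailingDegree) =>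
      coeff_eq_zero_of_lt_natTrailingDegree hd)
    refine ⟨e, he, fun h0 => hd ?_⟩
    rw [← trailingCoeff_eq_zero, trailingCoeff]
    nth_rewrite 1 [he]
    rw [coeff_X_pow_mul', if_pos le_rfl, Nat.sub_self, coeff_zero_eq_eval_zero, h0]
  set m := (p₁ - p₂).natTrailingDegree with hm
  -- The degree bound enters here: it makes `x^n` vanish modulo `x^(m+2)`.
  have hmn : m + 2 ≤ n := by
    have := (natTrailingDegree_le_natDegree (p₁ - p₂)).trans (natDegree_sub_le p₁ p₂)
    omega
  set π := Ideal.Quotient.mk (Ideal.span {(X : ℂ[X]) ^ (m + 1 + 1)}) with hπ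
  have hT := isTruncated_truncResidue (m + 1)
  set Φ' : MvPolynomial (Fin 2) (ℂ[X] ⧸ Ideal.span {(X : ℂ[X]) ^ (m + 1 + 1)}) →ₐ[_]
      MvPolynomial (Fin 2) (ℂ[X] ⧸ Ideal.span {(X : ℂ[X]) ^ (m + 1 + 1)}) :=
    MvPolynomial.aeval fun i => MvPolynomial.map π (Φ (MvPolynomial.X i)) with hΦ'
  have hX : ∀ i, Φ' (MvPolynomial.X i) = MvPolynomial.map π (Φ (MvPolynomial.X i)) :=
    fun i => by rw [hΦ', MvPolynomial.aeval_X]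
  have hmap : ∀ f, Φ' (MvPolynomial.map π f) = MvPolynomial.map π (Φ f) := fun f => by
    induction f using MvPolynomial.induction_on with
    | C a =>
      have h1 : Φ (MvPolynomial.C a) = MvPolynomial.C a := Φ.commutes a
      have h2 : Φ' (MvPolynomial.C (π a)) = MvPolynomial.C (π a) := Φ'.commutes (π a)
      rw [h1, MvPolynomial.map_C, h2]
    | add p q hp hq => simp only [map_add, hp, hq]
    | mul_X p i hp => rw [map_mul, map_mul, hp, MvPolynomial.map_X, hX, map_mul, map_mul]
  have hgen : ∀ p : ℂ[X], MvPolynomial.map π (zVar ^ 2 + tVar ^ 3 + xVar * MvPolynomial.C p) =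
      cusp _ + MvPolynomial.C (π (X * p)) := fun p => by
    simp [zVar, tVar, xVar, cusp]
  have hmem : Φ (zVar ^ 2 + tVar ^ 3 + xVar * MvPolynomial.C p₁) ∈ centerIdeal n p₂ := by
    rw [← hI]
    exact Ideal.mem_map_of_mem _ (Ideal.subset_span (by simp))
  obtain ⟨v, u, hvu⟩ := Ideal.mem_span_pair.1 hmem
  have hu : Φ' (cusp _ + MvPolynomial.C (π (X * p₁))) =
      MvPolynomial.map π u * (cusp _ + MvPolynomial.C (π (X * p₂))) := by
    have hx : MvPolynomial.map π (xVar ^ n) = 0 := by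
      rw [xVar, map_pow, MvPolynomial.map_C, ← map_pow, pow_eq_zero_of_le hmn hT.pow_eq_zero,
        map_zero]
    rw [← hgen, hmap, ← hvu, map_add, map_mul, map_mul, hx, mul_zero, zero_add, hgen]
  have hcongr : ∀ i, ∃ α, Φ' (MvPolynomial.X i) = MvPolynomial.X i + π X • α := fun i => by
    obtain ⟨α, hα⟩ := exists_eq_add_smul (hΦ (MvPolynomial.X i))
    exact ⟨MvPolynomial.map π α, by rw [hX, hα, map_add, map_smul_eq, MvPolynomial.map_X]⟩
  obtain ⟨α, hα⟩ := hcongr 0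
  obtain ⟨β, hβ⟩ := hcongr 1
  refine he0 (hT.residue_eq_zero (k := m + 1) (a := π e) (by omega)
    (s₁ := π (X * p₁)) (s₂ := π (X * p₂)) ?_ ?_ ?_ hα hβ hu)
  · rw [truncResidue_mk, eval_mul, eval_X, zero_mul]
  · rw [← map_pow, ← map_mul, ← map_add]
    congr 1
    linear_combination X * he
  · rw [hX, hX, poisson_map, poisson_algEquiv_eq_one Φ hΦ, map_one]
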